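/- **Setting.** Let $F:\mathbb R^d\to\mathbb R$ be a $C^3$ objective with $\|\nabla F\|\le G$, $\|\nabla^2F\|\le L$, $\|\nabla^3F\|\le L'$ everywhere, bounded below with $F(x_0)-\inf F\le\Delta_0$, and $\mu$-strongly convex on the ball of radius $r$ around every local minimizer $x_{loc}$ of $F$ ($\mu,r>0$). Client $i\in\{1,\dots,N\}$ has access to stochastic gradients $\nabla F_i(x;\xi)$, $\xi\sim\mathcal D_i$, with $\mathbb E\,\nabla F_i(x;\xi)=\nabla F(x)$ and $\mathbb E\|\nabla F_i(x;\xi)-\nabla F(x)\|^\alpha\le D^\alpha$ for all $x$, where $\alpha\in(1,2)$ and $D>0$. All samples drawn in a run are independent. $\mathrm{Clip}(u,\cdot)$ denotes coordinate-wise clipping to $[-u,u]$ and $\odot$ the element-wise product. **Algorithm ($Clip^2$ with delay compensation).** Fix a buffer size $M\ge1$ and a number of local steps $K\ge1$. At each round $t=1,\dots,T$ the server aggregates $M$ client updates; the $m$-th one was computed by a client $i$ starting from the global model $x_s$ of an earlier round $s=\tau_{t,m}\le t-1$, with the (deterministic, otherwise arbitrary) schedule satisfying $t-\tau_{t,m}\le\tau$.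 The client sets $y_0=x_s$ and, for $k=0,\dots,K-1$, draws $g_k=\nabla F_i(y_k;\xi_k)$ with a fresh sample and sets $y_{k+1}=y_k-\eta_\ell^{s}\,\mathrm{Clip}(u_s,g_k)$; it also forms $A=\sum_{k<K}(\eta_\ell^{s})^2\,\mathrm{Clip}(u_s,g_k)\odot\mathrm{Clip}(u_s,g_k)$. With $y_K^{(m)},A^{(m)}$ the quantities received in round $t$, the server sets $$x_t=x_{t-1}+\eta_t\,\mathrm{Clip}\Big(\tilde u_t,\ \frac1M\sum_{m=1}^M\big[(y^{(m)}_K-x_{\tau_{t,m}})-A^{(m)}\odot(x_{t-1}-x_{\tau_{t,m}})\big]\Big).$$ **Hessian-gap condition.** There are constants $B_1,B_2$, independent of $T$, such that for every local minimizer $x_{loc}$ of $F$ and every local step in the run, performed at the local model $y$ with stochastic gradient $g$ and clipping threshold $u_s$, $$\big\|\mathbb E[\mathrm{Clip}(u_s,g)^{\odot2}]-\mathbb E[\mathrm{diag}\,\nabla^2F(y)]\big\|\le B_1\,\mathbb E\|y-x_{loc}\|+B_2 .$$ **Theorem.** For a run of $T\ge 1$ rounds let, for all rounds $t$ and $s$,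 $\eta_t=\Theta(T^{\omega})$, $\eta_\ell^s=\Theta(T^{\nu})$, $u_s=\Theta(T^{\zeta})$, $\tilde u_t=\Theta(T^{\tilde\zeta})$ with $$\omega=-\tfrac12,\qquad \nu=-\tfrac{\alpha}{4\alpha-2},\qquad \zeta=\tfrac1{4\alpha-2},\qquad \tilde\zeta=0,$$ and let the maximum delay satisfy $\tau\le O\big(T^{\alpha/(4\alpha-2)}\big)$. Then $$\min_{1\le t\le T}\mathbb E\|\nabla F(x_{t-1})\|^2\le C\,T^{\frac{1-\alpha}{4\alpha-2}},$$ where $C$ depends only on $d,N,M,K,\alpha,D,G,L,L',\Delta_0,\mu,r,B_1,B_2$ and the constants in the $\Theta(\cdot)$ and $O(\cdot)$ assumptions (not on $T$). -/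

import Mathlib

open MeasureTheory ProbabilityTheory

noncomputable section

/-- Model parameters: `ℝ^d` with the Euclidean norm. -/
abbrev Vec (d : ℕ) : Type := EuclideanSpace ℝ (Fin d)

namespace DelayComp

/-- Coordinate-wise clipping at threshold `u ≥ 0`. -/
def clip {d : ℕ} (u : ℝ) (x : Vec d) : Vec d :=
  WithLp.toLp 2 fun j => max (-u) (min u (x j))

/-- Element-wise product. -/
def hadamard {d : ℕ} (x y : Vec d) : Vec d :=
  WithLp.toLp 2 fun j => x j * y j

/-- The diagonal of the Hessian of `F` at `x`, as a vector. -/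
def hessDiag {d : ℕ} (F : Vec d → ℝ) (x : Vec d) : Vec d :=
  WithLp.toLp 2 fun j => iteratedFDeriv ℝ 2 F x fun _ => EuclideanSpace.single j (1 : ℝ)

/-- Hyperparameters, indexed by the global round. -/
structure Hyper where
  /-- global (server) learning rate -/
  globalLR : ℕ → ℝ
  /-- local (client) learning rate -/
  localLR : ℕ → ℝ
  /-- local clipping threshold -/
  localClip : ℕ → ℝ
  /-- global clipping threshold -/
  globalClip : ℕ → ℝ

/-- An asynchronous schedule with `N` clients and buffer size `M`: the `m`-th update aggregated at
round `t ≥ 1` was computed by client `client t m`, starting from the global model of the earlier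
round `start t m`. -/
structure Schedule (N M : ℕ) where
  client : ℕ → Fin M → Fin N
  start : ℕ → Fin M → ℕ
  start_lt : ∀ t m, start (t + 1) m < t + 1

/-- The maximum delay over the rounds `1, …, T`. -/
def Schedule.maxDelay {N M : ℕ} (S : Schedule N M) (T : ℕ) : ℕ :=
  (Finset.Icc 1 T ×ˢ (Finset.univ : Finset (Fin M))).sup fun p => p.1 - S.start p.1 p.2

section Algorithm

variable {d : ℕ} {Z : Type*}

/-- Local iterates of a client that starts from `x`, with local learning rate `a`, clipping
threshold `u`, stochastic gradient `g` and samples `z 0, z 1, …`. -/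
def localModel (g : Vec d → Z → Vec d) (a u : ℝ) (x : Vec d) (z : ℕ → Z) : ℕ → Vec d
  | 0 => x
  | k + 1 => localModel g a u x z k - a • clip u (g (localModel g a u x z k) (z k))

/-- The clipped stochastic gradient at the `k`-th local iterate. -/
def clippedGrad (g : Vec d → Z → Vec d) (a u : ℝ) (x : Vec d) (z : ℕ → Z) (k : ℕ) : Vec d :=
  clip u (g (localModel g a u x z k) (z k))

/-- The accumulated diagonal Hessian proxy that a client sends after `K` local steps. -/
def hessProxy (g : Vec d → Z → Vec d) (a u : ℝ) (x : Vec d) (z : ℕ → Z) (K : ℕ) : Vec d :=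
  ∑ k ∈ Finset.range K, a ^ 2 • hadamard (clippedGrad g a u x z k) (clippedGrad g a u x z k)

/-- The compensated contribution of one client update that was started from the stale global model
`y`, when the current global model is `x`. -/
def compensated (g : Vec d → Z → Vec d) (a u : ℝ) (K : ℕ) (x y : Vec d) (z : ℕ → Z) : Vec d :=
  (localModel g a u y z K - y) - hadamard (hessProxy g a u y z K) (x - y)

/-- The global models of doubly clipped asynchronous training with delay compensation: client `i`
queries the stochastic gradient `g i`, and `z t m k` is the sample used in local step `k` of the
`m`-th update aggregated at round `t`. -/
def globalModel {N M : ℕ} (g : Fin N → Vec d → Z → Vec d) (h : Hyper) (S : Schedule N M) (K : ℕ)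
    (x₀ : Vec d) (z : ℕ → Fin M → ℕ → Z) : ℕ → Vec d
  | 0 => x₀
  | t + 1 =>
      globalModel g h S K x₀ z t + h.globalLR (t + 1) • clip (h.globalClip (t + 1))
        ((M : ℝ)⁻¹ • ∑ m : Fin M,
          compensated (g (S.client (t + 1) m)) (h.localLR (S.start (t + 1) m))
            (h.localClip (S.start (t + 1) m)) K
            (globalModel g h S K x₀ z t)
            (globalModel g h S K x₀ z (S.start (t + 1) m)) (z (t + 1) m))
  termination_by t => t
  decreasing_by
    all_goals first
      | exact S.start_lt t m
      | exact Nat.lt_succ_self t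

/-- The `k`-th local iterate of the `m`-th update aggregated at round `t`. -/
def jobModel {N M : ℕ} (g : Fin N → Vec d → Z → Vec d) (h : Hyper) (S : Schedule N M) (K : ℕ)
    (x₀ : Vec d) (z : ℕ → Fin M → ℕ → Z) (t : ℕ) (m : Fin M) (k : ℕ) : Vec d :=
  localModel (g (S.client t m)) (h.localLR (S.start t m)) (h.localClip (S.start t m))
    (globalModel g h S K x₀ z (S.start t m)) (z t m) k

/-- The clipped stochastic gradient at the `k`-th local iterate of the `m`-th update aggregated at
round `t`. -/
def jobClippedGrad {N M : ℕ} (g : Fin N → Vec d → Z → Vec d) (h : Hyper) (S : Schedule N M) (K : ℕ)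
    (x₀ : Vec d) (z : ℕ → Fin M → ℕ → Z) (t : ℕ) (m : Fin M) (k : ℕ) : Vec d :=
  clippedGrad (g (S.client t m)) (h.localLR (S.start t m)) (h.localClip (S.start t m))
    (globalModel g h S K x₀ z (S.start t m)) (z t m) k

end Algorithm

/-- Assumptions on the objective: three times continuously differentiable with first, second and
third derivatives bounded by `G`, `L`, `L'`, initial gap at most `Δ₀` (so `F` is bounded below),
and `μ`-strongly convex on the `r`-ball around every local minimizer. -/
structure IsObjective {d : ℕ} (F : Vec d → ℝ) (x₀ : Vec d) (G L L' Δ₀ μ r : ℝ) : Prop where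
  contDiff : ContDiff ℝ 3 F
  grad_le : ∀ x, ‖gradient F x‖ ≤ G
  second_le : ∀ x, ‖iteratedFDeriv ℝ 2 F x‖ ≤ L
  third_le : ∀ x, ‖iteratedFDeriv ℝ 3 F x‖ ≤ L'
  gap_le : ∀ x, F x₀ - F x ≤ Δ₀
  strongConvex : ∀ xloc, IsLocalMin F xloc → StrongConvexOn (Metric.ball xloc r) μ F

/-- The stochastic gradients `g i x ·`, under the sampling law `𝒟 i` of client `i`, are unbiased
with noise of `α`-th moment at most `D ^ α`. -/
structure IsHeavyTailed {d N : ℕ} {Z : Type*} [MeasurableSpace Z] (F : Vec d → ℝ)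
    (g : Fin N → Vec d → Z → Vec d) (𝒟 : Fin N → Measure Z) (α D : ℝ) : Prop where
  prob : ∀ i, IsProbabilityMeasure (𝒟 i)
  meas : ∀ i, Measurable fun p : Vec d × Z => g i p.1 p.2
  integrable : ∀ i x, Integrable (g i x) (𝒟 i)
  unbiased : ∀ i x, ∫ ζ, g i x ζ ∂(𝒟 i) = gradient F x
  moment : ∀ i x, ∫⁻ ζ, ENNReal.ofReal (‖g i x ζ - gradient F x‖ ^ α) ∂(𝒟 i)
    ≤ ENNReal.ofReal (D ^ α)

/-- The samples used in the first `T` rounds are independent, and those drawn by client `i` have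
law `𝒟 i`. -/
structure IsSampling {N M : ℕ} {Ω Z : Type*} [MeasurableSpace Ω] [MeasurableSpace Z]
    (P : Measure Ω) (𝒟 : Fin N → Measure Z) (S : Schedule N M) (K T : ℕ)
    (z : ℕ → Fin M → ℕ → Ω → Z) : Prop where
  meas : ∀ t ∈ Finset.Icc 1 T, ∀ m, ∀ k < K, Measurable (z t m k)
  law : ∀ t ∈ Finset.Icc 1 T, ∀ m, ∀ k < K, P.map (z t m k) = 𝒟 (S.client t m)
  indep : iIndepFun (fun (p : Finset.Icc 1 T × Fin M × Fin K) => z p.1 p.2.1 p.2.2) P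

/-- The hyperparameters of a run of `T` rounds are `Θ(T^ω)`, `Θ(T^ν)`, `Θ(T^ζ)`, `Θ(T^ζ')`, with
the constants `c` (lower) and `c'` (upper). -/
structure Hyper.IsTheta (h : Hyper) (T : ℕ) (c c' ω ν ζ ζ' : ℝ) : Prop where
  globalLR : ∀ t ∈ Finset.Icc 1 T,
    c * (T : ℝ) ^ ω ≤ h.globalLR t ∧ h.globalLR t ≤ c' * (T : ℝ) ^ ω
  localLR : ∀ s < T, c * (T : ℝ) ^ ν ≤ h.localLR s ∧ h.localLR s ≤ c' * (T : ℝ) ^ ν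
  localClip : ∀ s < T, c * (T : ℝ) ^ ζ ≤ h.localClip s ∧ h.localClip s ≤ c' * (T : ℝ) ^ ζ
  globalClip : ∀ t ∈ Finset.Icc 1 T,
    c * (T : ℝ) ^ ζ' ≤ h.globalClip t ∧ h.globalClip t ≤ c' * (T : ℝ) ^ ζ'

/-- Along the run, the mean of the squared clipped stochastic gradient differs from the mean of the
diagonal Hessian by at most `B₁` times the mean distance to any local minimizer, plus `B₂`. -/
def HessianGap {d N M : ℕ} {Ω Z : Type*} [MeasurableSpace Ω] (P : Measure Ω) (F : Vec d → ℝ)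
    (g : Fin N → Vec d → Z → Vec d) (h : Hyper) (S : Schedule N M) (K T : ℕ) (x₀ : Vec d)
    (z : ℕ → Fin M → ℕ → Ω → Z) (B₁ B₂ : ℝ) : Prop :=
  ∀ xloc, IsLocalMin F xloc → ∀ t ∈ Finset.Icc 1 T, ∀ m : Fin M, ∀ k < K,
    ‖(∫ w, hadamard (jobClippedGrad g h S K x₀ (fun t m k => z t m k w) t m k)
          (jobClippedGrad g h S K x₀ (fun t m k => z t m k w) t m k) ∂P)
        - ∫ w, hessDiag F (jobModel g h S K x₀ (fun t m k => z t m k w) t m k) ∂P‖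
      ≤ B₁ * (∫ w, ‖jobModel g h S K x₀ (fun t m k => z t m k w) t m k - xloc‖ ∂P) + B₂

end DelayComp

end

/-! Write ρ = T^((1-α)/(4α-2)). The argument is the descent lemma at the current global model, with
exponents chosen so that every relative error is O(ρ). Coordinate-wise clipping of a gradient with
bounded α-th moment has bias O(u^(1-α)) = O(ρ) (`IsHeavyTailed.norm_gradient_sub_integral_clip_le`).
Local drift is O(η_ℓ u) = O(ρ) (`norm_localModel_sub_le`). Global clipping caps each server step, so
a stale model lies within O(τ η ũ) = O(ρ) of the current one (`norm_globalModel_sub_le`). The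
compensation term enters only as an error: E‖Clip²‖ ≤ u E‖g‖, so relative to η_ℓ it costs η_ℓ u
times the staleness, again O(ρ).

Hence the gradient at the current model correlates with each update as -η_ℓ K (E‖∇F‖² - O(ρ))
(`IsSampling.integral_inner_jobUpdate_le`). Updates have norm O(ρ), so for ρ small the global
clipping is inactive, and for ρ bounded below the trivial bound G² suffices. If E‖∇F‖² exceeded Cρ
in every round, summing would give a first-order decrease of order T η η_ℓ ρ C, that is a multiple
of C, against a second-order loss of order T η² ρ² ≤ 1. For large C this contradicts the initial gap
Δ₀ (`exists_integral_norm_gradient_sq_le`). -/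

namespace DelayComp

/-! ### Clipping and the element-wise product -/

section Clip

variable {d : ℕ}

theorem norm_le_mul_norm_of_coord {x y : Vec d} {b : ℝ} (hb : 0 ≤ b)
    (h : ∀ j, |x j| ≤ b * |y j|) : ‖x‖ ≤ b * ‖y‖ := by
  refine abs_le_of_sq_le_sq' ?_ (by positivity) |>.2
  rw [mul_pow, EuclideanSpace.norm_sq_eq, EuclideanSpace.norm_sq_eq, Finset.mul_sum]
  refine Finset.sum_le_sum fun j _ => ?_
  rw [← mul_pow]
  exact pow_le_pow_left₀ (norm_nonneg _) (h j) 2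

theorem norm_le_sqrt_mul_of_coord {x : Vec d} {b : ℝ} (hb : 0 ≤ b)
    (h : ∀ j, |x j| ≤ b) : ‖x‖ ≤ √d * b := by
  refine abs_le_of_sq_le_sq' ?_ (by positivity) |>.2
  rw [mul_pow, EuclideanSpace.norm_sq_eq, Real.sq_sqrt (Nat.cast_nonneg d)]
  calc ∑ j, ‖x j‖ ^ 2 ≤ ∑ _j : Fin d, b ^ 2 :=
        Finset.sum_le_sum fun j _ => pow_le_pow_left₀ (norm_nonneg _) (h j) 2
    _ = d * b ^ 2 := by simp

theorem clip_apply (u : ℝ) (x : Vec d) (j : Fin d) :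
    clip u x j = max (-u) (min u (x j)) := rfl

theorem hadamard_apply (x y : Vec d) (j : Fin d) : hadamard x y j = x j * y j := rfl

theorem abs_clip_le {u : ℝ} (hu : 0 ≤ u) (x : Vec d) (j : Fin d) : |clip u x j| ≤ u := by
  rw [clip_apply, abs_le]
  exact ⟨le_max_left _ _, max_le (by linarith) (min_le_left _ _)⟩

theorem abs_clip_le_abs {u : ℝ} (hu : 0 ≤ u) (x : Vec d) (j : Fin d) :
    |clip u x j| ≤ |x j| := by
  rw [clip_apply]
  rcases max_cases (-u) (min u (x j)) with h | h <;> rcases min_cases u (x j) with h' | h' <;>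
    rw [abs_le] <;> constructor <;> cases abs_cases (x j) <;> linarith

theorem abs_sub_clip_le {u : ℝ} (hu : 0 ≤ u) (x : Vec d) (j : Fin d) :
    |x j - clip u x j| ≤ |x j| := by
  rw [clip_apply]
  rcases max_cases (-u) (min u (x j)) with h | h <;> rcases min_cases u (x j) with h' | h' <;>
    rw [abs_le] <;> constructor <;> cases abs_cases (x j) <;> linarith

theorem clip_eq_self {u : ℝ} {x : Vec d} (h : ‖x‖ ≤ u) : clip u x = x := by
  ext j
  have hj : |x j| ≤ u := (PiLp.norm_apply_le x j).trans h
  rw [abs_le] at hj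
  rw [clip_apply, min_eq_right hj.2, max_eq_right hj.1]

theorem norm_clip_le {u : ℝ} (hu : 0 ≤ u) (x : Vec d) : ‖clip u x‖ ≤ √d * u :=
  norm_le_sqrt_mul_of_coord hu (abs_clip_le hu x)

theorem norm_sub_clip_le_norm {u : ℝ} (hu : 0 ≤ u) (x : Vec d) : ‖x - clip u x‖ ≤ ‖x‖ := by
  simpa using norm_le_mul_norm_of_coord zero_le_one (x := x - clip u x) (y := x)
    fun j => by simpa using abs_sub_clip_le hu x j

/-- The clipping error is controlled by any moment of order above one. -/
theorem norm_sub_clip_le {u α : ℝ} (hu : 0 < u) (hα : 1 ≤ α) (x : Vec d) :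
    ‖x - clip u x‖ ≤ u ^ (1 - α) * ‖x‖ ^ α := by
  rcases le_or_gt ‖x‖ u with h | h
  · rw [clip_eq_self h, sub_self, norm_zero]
    positivity
  · refine (norm_sub_clip_le_norm hu.le x).trans ?_
    have hx : 0 < ‖x‖ := hu.trans h
    calc ‖x‖ = ‖x‖ ^ (1 - α) * ‖x‖ ^ α := by
          rw [← Real.rpow_add hx]; simp
      _ ≤ u ^ (1 - α) * ‖x‖ ^ α := by
          gcongr ?_ * _
          exact Real.rpow_le_rpow_of_nonpos hu h.le (by linarith)

theorem norm_hadamard_le (x y : Vec d) : ‖hadamard x y‖ ≤ ‖x‖ * ‖y‖ :=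
  norm_le_mul_norm_of_coord (norm_nonneg x) fun j => by
    rw [hadamard_apply, abs_mul]
    gcongr
    exact PiLp.norm_apply_le x j

/-- One factor is bounded by `u` and the other is kept, so a first moment of `x` controls the mean;
the second moment of a heavy-tailed gradient may be infinite. -/
theorem norm_hadamard_clip_le {u : ℝ} (hu : 0 ≤ u) (x : Vec d) :
    ‖hadamard (clip u x) (clip u x)‖ ≤ u * ‖x‖ :=
  norm_le_mul_norm_of_coord hu fun j => by
    rw [hadamard_apply, abs_mul]
    exact mul_le_mul (abs_clip_le hu x j) (abs_clip_le_abs hu x j) (abs_nonneg _) hu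

theorem norm_hadamard_clip_le' {u : ℝ} (hu : 0 ≤ u) (x : Vec d) :
    ‖hadamard (clip u x) (clip u x)‖ ≤ √d * (u * u) :=
  norm_le_sqrt_mul_of_coord (by positivity) fun j => by
    rw [hadamard_apply, abs_mul]
    exact mul_le_mul (abs_clip_le hu x j) (abs_clip_le hu x j) (abs_nonneg _) hu

theorem continuous_clip (u : ℝ) : Continuous (clip u : Vec d → Vec d) := by
  unfold clip
  fun_prop

theorem continuous_hadamard : Continuous fun p : Vec d × Vec d => hadamard p.1 p.2 := by
  unfold hadamard
  fun_prop

end Clip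

/-! ### Consequences of a bounded second derivative -/

section Smooth

variable {d : ℕ} {F : Vec d → ℝ} {L : ℝ}

theorem norm_fderiv_sub_le (hF : ContDiff ℝ 2 F) (hL : ∀ x, ‖iteratedFDeriv ℝ 2 F x‖ ≤ L)
    (x y : Vec d) : ‖fderiv ℝ F y - fderiv ℝ F x‖ ≤ L * ‖y - x‖ := by
  have h1 : ContDiff ℝ 1 (fderiv ℝ F) := hF.fderiv_right (by norm_num)
  refine convex_univ.norm_image_sub_le_of_norm_fderiv_le (𝕜 := ℝ)
    (fun z _ => (h1.differentiable (by norm_num)) z) (fun z _ => ?_) (Set.mem_univ x)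
    (Set.mem_univ y)
  refine le_trans (le_of_eq ?_) (hL z)
  rw [← norm_iteratedFDeriv_fderiv (n := 1), norm_iteratedFDeriv_one]

theorem norm_gradient_sub_le (hF : ContDiff ℝ 2 F) (hL : ∀ x, ‖iteratedFDeriv ℝ 2 F x‖ ≤ L)
    (x y : Vec d) : ‖gradient F y - gradient F x‖ ≤ L * ‖y - x‖ := by
  unfold gradient
  rw [← map_sub, LinearIsometryEquiv.norm_map]
  exact norm_fderiv_sub_le hF hL x y

theorem continuous_gradient (hF : ContDiff ℝ 1 F) : Continuous (gradient F) :=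
  (LinearIsometryEquiv.continuous _).comp (hF.continuous_fderiv (by norm_num))

/-- Quadratic upper bound for a function with bounded second derivative. -/
theorem sub_le_inner_gradient_add (hF : ContDiff ℝ 2 F)
    (hL : ∀ x, ‖iteratedFDeriv ℝ 2 F x‖ ≤ L) (x y : Vec d) :
    F y - F x ≤ inner ℝ (gradient F x) (y - x) + L * ‖y - x‖ ^ 2 := by
  have hL0 : 0 ≤ L := (norm_nonneg _).trans (hL x)
  -- The mean value inequality for `F - fderiv ℝ F x` on the segment gives the constant `L` instead
  -- of `L / 2`, which is enough here.
  have h := (convex_segment x y).norm_image_sub_le_of_norm_fderiv_le' (𝕜 := ℝ) (f := F)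
    (φ := fderiv ℝ F x) (C := L * ‖y - x‖)
    (fun z _ => (hF.differentiable (by norm_num)) z)
    (fun z hz => (norm_fderiv_sub_le hF hL x z).trans
      (by gcongr; exact norm_sub_le_of_mem_segment hz))
    (left_mem_segment ℝ x y) (right_mem_segment ℝ x y)
  have h2 := (le_abs_self _).trans h
  have h3 : inner ℝ (gradient F x) (y - x) = fderiv ℝ F x (y - x) := by
    simp [gradient]
  rw [h3]
  nlinarith

end Smooth

/-! ### Measurability of the iterates -/

section Measurability

variable {d : ℕ} {Ω Z : Type*} [MeasurableSpace Ω] [MeasurableSpace Z]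

/-- Only the samples with index below `n` need to be measurable. As the σ-algebra on `Ω` is
arbitrary, these lemmas also apply to the one generated by all samples but one, and so yield
independence. -/
theorem measurable_localModel {g : Vec d → Z → Vec d}
    (hg : Measurable fun p : Vec d × Z => g p.1 p.2) (a u : ℝ) {x : Ω → Vec d}
    (hx : Measurable x) {z : ℕ → Ω → Z} {n : ℕ} (hz : ∀ k < n, Measurable (z k)) :
    Measurable fun w => localModel g a u (x w) (fun k => z k w) n := by
  induction n with
  | zero => exact hx
  | succ n ih =>
    have h := ih fun k hk => hz k (by omega)
    exact h.sub (((continuous_clip u).measurable.comp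
      (hg.comp (h.prodMk (hz n (by omega))))).const_smul a)

theorem measurable_clippedGrad {g : Vec d → Z → Vec d}
    (hg : Measurable fun p : Vec d × Z => g p.1 p.2) (a u : ℝ) {x : Ω → Vec d}
    (hx : Measurable x) {z : ℕ → Ω → Z} {n : ℕ} (hz : ∀ k < n, Measurable (z k)) {k : ℕ}
    (hk : k < n) : Measurable fun w => clippedGrad g a u (x w) (fun k => z k w) k :=
  (continuous_clip u).measurable.comp (hg.comp
    ((measurable_localModel hg a u hx fun i hi => hz i (by omega)).prodMk (hz k hk)))

theorem measurable_compensated {g : Vec d → Z → Vec d}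
    (hg : Measurable fun p : Vec d × Z => g p.1 p.2) (a u : ℝ) {x y : Ω → Vec d}
    (hx : Measurable x) (hy : Measurable y) {z : ℕ → Ω → Z} {K : ℕ}
    (hz : ∀ k < K, Measurable (z k)) :
    Measurable fun w => compensated g a u K (x w) (y w) (fun k => z k w) := by
  have hA : Measurable fun w => hessProxy g a u (y w) (fun k => z k w) K := by
    unfold hessProxy
    refine Finset.measurable_sum _ fun k hk => ?_
    have h := measurable_clippedGrad hg a u hy hz (Finset.mem_range.1 hk)
    exact (continuous_hadamard.measurable.comp (h.prodMk h)).const_smul (a ^ 2)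
  exact ((measurable_localModel hg a u hy hz).sub hy).sub
    (continuous_hadamard.measurable.comp (hA.prodMk (hx.sub hy)))

theorem measurable_globalModel {N M : ℕ} {g : Fin N → Vec d → Z → Vec d}
    (hg : ∀ i, Measurable fun p : Vec d × Z => g i p.1 p.2) (h : Hyper) (S : Schedule N M)
    (K : ℕ) (x₀ : Vec d) {z : ℕ → Fin M → ℕ → Ω → Z} {n : ℕ}
    (hz : ∀ t ∈ Finset.Icc 1 n, ∀ m, ∀ k < K, Measurable (z t m k)) {t : ℕ} (ht : t ≤ n) :
    Measurable fun w => globalModel g h S K x₀ (fun t m k => z t m k w) t := by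
  induction t using Nat.strong_induction_on with
  | _ t ih =>
    match t, ht, ih with
    | 0, _, _ => simp only [globalModel]; exact measurable_const
    | t + 1, ht, ih =>
      simp only [globalModel]
      have h1 := ih t (by omega) (by omega)
      refine h1.add (((continuous_const_smul (h.globalLR (t + 1))).comp ((continuous_clip
        (h.globalClip (t + 1))).comp (continuous_const_smul (M : ℝ)⁻¹))).measurable.comp
        (Finset.measurable_fun_sum _ fun m _ => ?_))
      have h2 := S.start_lt t m
      exact measurable_compensated (hg _) _ _ h1 (ih _ h2 (by omega))
        (hz (t + 1) (Finset.mem_Icc.2 ⟨by omega, ht⟩) m)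

theorem measurable_jobModel {N M : ℕ} {g : Fin N → Vec d → Z → Vec d}
    (hg : ∀ i, Measurable fun p : Vec d × Z => g i p.1 p.2) (h : Hyper) (S : Schedule N M)
    (K : ℕ) (x₀ : Vec d) {z : ℕ → Fin M → ℕ → Ω → Z} {t : ℕ}
    (hz : ∀ s ∈ Finset.Icc 1 t, ∀ m, ∀ k < K, Measurable (z s m k)) (m : Fin M) {k : ℕ}
    (hz' : ∀ i < k, Measurable (z (t + 1) m i)) :
    Measurable fun w => jobModel g h S K x₀ (fun t m k => z t m k w) (t + 1) m k :=
  measurable_localModel (hg _) _ _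
    (measurable_globalModel hg h S K x₀ hz (Nat.lt_succ_iff.1 (S.start_lt t m))) hz'

end Measurability

/-! ### Independence of a sample from the models it meets -/

section Independence

variable {d N M K T : ℕ} {Ω Z : Type*} [MeasurableSpace Ω] [MeasurableSpace Z]
  {P : Measure Ω} {𝒟 : Fin N → Measure Z} {g : Fin N → Vec d → Z → Vec d}
  {S : Schedule N M} {z : ℕ → Fin M → ℕ → Ω → Z}

/-- A sample is independent of the current global model and of the local model at which it is
used. -/
theorem IsSampling.indepFun_models (hz : IsSampling P 𝒟 S K T z)
    (hg : ∀ i, Measurable fun p : Vec d × Z => g i p.1 p.2) (h : Hyper) (x₀ : Vec d)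
    {t : ℕ} (ht : t < T) (m : Fin M) {k : ℕ} (hk : k < K) :
    IndepFun (fun w => (globalModel g h S K x₀ (fun t m k => z t m k w) t,
      jobModel g h S K x₀ (fun t m k => z t m k w) (t + 1) m k)) (z (t + 1) m k) P := by
  let f : (Finset.Icc 1 T × Fin M × Fin K) → Ω → Z := fun p => z p.1 p.2.1 p.2.2
  let p₀ : Finset.Icc 1 T × Fin M × Fin K :=
    (⟨t + 1, Finset.mem_Icc.2 ⟨by omega, ht⟩⟩, m, ⟨k, hk⟩)
  let 𝓜 : (Finset.Icc 1 T × Fin M × Fin K) → MeasurableSpace Ω := fun p =>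
    MeasurableSpace.comap (f p) inferInstance
  have hle : ∀ p, 𝓜 p ≤ ‹MeasurableSpace Ω› := fun p =>
    (hz.meas p.1 p.1.2 p.2.1 p.2.2 p.2.2.2).comap_le
  -- The σ-algebra of sample `p₀` is independent of the one generated by all the others; it remains
  -- to see that both models are measurable for the latter.
  have hind := indep_iSup_of_disjoint hle hz.indep.iIndep
    (disjoint_compl_left (a := ({p₀} : Set _)))
  have hmeas : ∀ p, p ≠ p₀ → Measurable[⨆ p ∈ ({p₀}ᶜ : Set _), 𝓜 p] (f p) := fun p hp =>
    Measurable.mono (comap_measurable (f p)) (le_biSup 𝓜 (by simpa using hp)) le_rfl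
  -- Samples are indexed by the round that aggregates them, so the global model `t` uses none of
  -- round `t + 1`, however stale the job is.
  have hz₁ : ∀ s ∈ Finset.Icc 1 t, ∀ m', ∀ k' < K,
      Measurable[⨆ p ∈ ({p₀}ᶜ : Set _), 𝓜 p] (z s m' k') := by
    intro s hs m' k' hk'
    rw [Finset.mem_Icc] at hs
    refine hmeas (⟨s, Finset.mem_Icc.2 ⟨hs.1, by omega⟩⟩, m', ⟨k', hk'⟩) fun hp => ?_
    have : s = t + 1 := congrArg (fun q => (q.1 : ℕ)) hp
    omega
  have hz₂ : ∀ i < k, Measurable[⨆ p ∈ ({p₀}ᶜ : Set _), 𝓜 p] (z (t + 1) m i) := by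
    intro i hi
    refine hmeas (⟨t + 1, Finset.mem_Icc.2 ⟨by omega, ht⟩⟩, m, ⟨i, by omega⟩) fun hp => ?_
    have : i = k := congrArg (fun q => (q.2.2 : ℕ)) hp
    omega
  rw [IndepFun_iff_Indep]
  refine indep_of_indep_of_le_left (indep_of_indep_of_le_right hind ?_) ?_
  · exact le_biSup 𝓜 (Set.mem_singleton p₀)
  · refine Measurable.comap_le ?_
    exact Measurable.prodMk
      (@measurable_globalModel d Ω Z (⨆ p ∈ ({p₀}ᶜ : Set _), 𝓜 p) _ N M g hg h S K x₀ z t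
        hz₁ t le_rfl)
      (@measurable_jobModel d Ω Z (⨆ p ∈ ({p₀}ᶜ : Set _), 𝓜 p) _ N M g hg h S K x₀ z t
        hz₁ m k hz₂)

/-- The joint law is a product, so Fubini allows `X` to be frozen while the fresh sample is averaged
out. This plays the role of conditional expectation. -/
theorem integral_comp_prodMk_of_indepFun {E : Type*} [MeasurableSpace E]
    [IsProbabilityMeasure P] {X : Ω → E} {ζ : Ω → Z} {ρ : Measure Z} [IsProbabilityMeasure ρ]
    (hX : Measurable X) (hζ : Measurable ζ) (hind : IndepFun X ζ P) (hlaw : P.map ζ = ρ)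
    {φ : E × Z → ℝ} (hφ : Measurable φ) {B : ℝ} (hB : ∀ p, |φ p| ≤ B) :
    Integrable (fun w => ∫ s, φ (X w, s) ∂ρ) P ∧
      ∫ w, φ (X w, ζ w) ∂P = ∫ w, ∫ s, φ (X w, s) ∂ρ ∂P := by
  have : IsProbabilityMeasure (P.map X) := Measure.isProbabilityMeasure_map hX.aemeasurable
  have hmap := (indepFun_iff_map_prod_eq_prod_map_map hX.aemeasurable hζ.aemeasurable).1 hind
  rw [hlaw] at hmap
  have hint : Integrable φ ((P.map X).prod ρ) :=
    Integrable.of_bound hφ.aestronglyMeasurable B (Filter.Eventually.of_forall hB)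
  have hinner := hint.integral_prod_left
  refine ⟨(integrable_map_measure hinner.aestronglyMeasurable hX.aemeasurable).1 hinner, ?_⟩
  rw [← integral_map hX.aemeasurable hinner.aestronglyMeasurable, ← integral_prod _ hint, ← hmap,
    integral_map (hX.prodMk hζ).aemeasurable hφ.aestronglyMeasurable]

end Independence

/-! ### Moments and clipping bias of the stochastic gradients -/

section Moments

variable {d N : ℕ} {Z : Type*} [MeasurableSpace Z] {F : Vec d → ℝ}
  {g : Fin N → Vec d → Z → Vec d} {𝒟 : Fin N → Measure Z} {α D G : ℝ}

/-- The sum is at most twice the larger term, and `2 ^ α ≤ 4`. -/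
theorem add_rpow_le_four_mul {a b α : ℝ} (ha : 0 ≤ a) (hb : 0 ≤ b) (h0 : 0 ≤ α) (h2 : α ≤ 2) :
    (a + b) ^ α ≤ 4 * (a ^ α + b ^ α) := by
  have h4 : (2 : ℝ) ^ α ≤ 4 := by
    calc (2 : ℝ) ^ α ≤ 2 ^ (2 : ℝ) := Real.rpow_le_rpow_of_exponent_le one_le_two h2
      _ = 4 := by norm_num
  have ha' := Real.rpow_nonneg ha α
  have hb' := Real.rpow_nonneg hb α
  rcases le_total a b with h | h
  · calc (a + b) ^ α ≤ (2 * b) ^ α := Real.rpow_le_rpow (by positivity) (by linarith) h0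
      _ = 2 ^ α * b ^ α := Real.mul_rpow zero_le_two hb
      _ ≤ 4 * (a ^ α + b ^ α) := by nlinarith
  · calc (a + b) ^ α ≤ (2 * a) ^ α := Real.rpow_le_rpow (by positivity) (by linarith) h0
      _ = 2 ^ α * a ^ α := Real.mul_rpow zero_le_two ha
      _ ≤ 4 * (a ^ α + b ^ α) := by nlinarith

theorem IsHeavyTailed.measurable_section (hg : IsHeavyTailed F g 𝒟 α D) (i : Fin N) (x : Vec d) :
    Measurable (g i x) :=
  (hg.meas i).comp measurable_prodMk_left

theorem IsHeavyTailed.integral_rpow_le (hg : IsHeavyTailed F g 𝒟 α D) (hD : 0 ≤ D)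
    (h0 : 0 ≤ α) (h2 : α ≤ 2) (hG : ∀ x, ‖gradient F x‖ ≤ G) (i : Fin N) (x : Vec d) :
    Integrable (fun s => ‖g i x s‖ ^ α) (𝒟 i) ∧
      ∫ s, ‖g i x s‖ ^ α ∂(𝒟 i) ≤ 4 * (G ^ α + D ^ α) := by
  have := hg.prob i
  have hm := hg.measurable_section i x
  have hm' : Measurable fun s => ‖g i x s - gradient F x‖ ^ α :=
    (hm.sub_const _).norm.pow_const α
  have hpos : 0 ≤ᵐ[𝒟 i] fun s => ‖g i x s - gradient F x‖ ^ α :=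
    Filter.Eventually.of_forall fun s => by positivity
  have hn : Integrable (fun s => ‖g i x s - gradient F x‖ ^ α) (𝒟 i) := by
    refine ⟨hm'.aestronglyMeasurable, ?_⟩
    rw [hasFiniteIntegral_iff_ofReal hpos]
    exact (hg.moment i x).trans_lt ENNReal.ofReal_lt_top
  have hn' : ∫ s, ‖g i x s - gradient F x‖ ^ α ∂(𝒟 i) ≤ D ^ α := by
    rw [integral_eq_lintegral_of_nonneg_ae hpos hm'.aestronglyMeasurable]
    exact ENNReal.toReal_le_of_le_ofReal (by positivity) (hg.moment i x)
  have hG0 : 0 ≤ G := (norm_nonneg _).trans (hG x)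
  have hle : ∀ s, ‖g i x s‖ ^ α ≤ 4 * (G ^ α + ‖g i x s - gradient F x‖ ^ α) := fun s => by
    refine le_trans (Real.rpow_le_rpow (norm_nonneg _) ?_ h0)
      (add_rpow_le_four_mul hG0 (norm_nonneg _) h0 h2)
    calc ‖g i x s‖ = ‖gradient F x + (g i x s - gradient F x)‖ := by simp
      _ ≤ G + ‖g i x s - gradient F x‖ := (norm_add_le _ _).trans (by gcongr; exact hG x)
  have hR : Integrable (fun s => 4 * (G ^ α + ‖g i x s - gradient F x‖ ^ α)) (𝒟 i) :=
    ((integrable_const _).add hn).const_mul 4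
  have hI : Integrable (fun s => ‖g i x s‖ ^ α) (𝒟 i) := by
    refine hR.mono' (hm.norm.pow_const α).aestronglyMeasurable
      (Filter.Eventually.of_forall fun s => ?_)
    rw [Real.norm_of_nonneg (by positivity)]
    exact hle s
  refine ⟨hI, (integral_mono hI hR hle).trans ?_⟩
  rw [integral_const_mul, integral_add (integrable_const _) hn]
  simp only [integral_const, probReal_univ, one_smul]
  linarith

theorem IsHeavyTailed.integral_norm_le (hg : IsHeavyTailed F g 𝒟 α D) (hD : 0 ≤ D)
    (h1 : 1 ≤ α) (h2 : α ≤ 2) (hG : ∀ x, ‖gradient F x‖ ≤ G) (i : Fin N) (x : Vec d) :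
    ∫ s, ‖g i x s‖ ∂(𝒟 i) ≤ 4 * (G ^ α + D ^ α) + 1 := by
  have := hg.prob i
  obtain ⟨hI, hle⟩ := hg.integral_rpow_le hD (by linarith) h2 hG i x
  calc ∫ s, ‖g i x s‖ ∂(𝒟 i) ≤ ∫ s, (‖g i x s‖ ^ α + 1) ∂(𝒟 i) := by
        -- Pointwise `s ≤ s ^ α + 1` for `s ≥ 0`, by comparing `s` with `1`.
        refine integral_mono (hg.integrable i x).norm (hI.add (integrable_const 1)) fun s => ?_
        rcases le_total ‖g i x s‖ 1 with h | h
        · have := Real.rpow_nonneg (norm_nonneg (g i x s)) α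
          dsimp only
          linarith
        · have := Real.rpow_le_rpow_of_exponent_le h h1
          rw [Real.rpow_one] at this
          dsimp only
          linarith
    _ ≤ 4 * (G ^ α + D ^ α) + 1 := by
        rw [integral_add hI (integrable_const _)]
        simpa using hle

theorem IsHeavyTailed.integrable_clip (hg : IsHeavyTailed F g 𝒟 α D) {u : ℝ} (hu : 0 ≤ u)
    (i : Fin N) (x : Vec d) : Integrable (fun s => clip u (g i x s)) (𝒟 i) := by
  have := hg.prob i
  exact Integrable.of_bound ((continuous_clip u).measurable.comp
    (hg.measurable_section i x)).aestronglyMeasurable (√d * u)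
    (Filter.Eventually.of_forall fun s => norm_clip_le hu _)

/-- The bias of a clipped heavy-tailed stochastic gradient. -/
theorem IsHeavyTailed.norm_gradient_sub_integral_clip_le (hg : IsHeavyTailed F g 𝒟 α D)
    (hD : 0 ≤ D) (h1 : 1 ≤ α) (h2 : α ≤ 2) (hG : ∀ x, ‖gradient F x‖ ≤ G) {u : ℝ} (hu : 0 < u)
    (i : Fin N) (x : Vec d) :
    ‖gradient F x - ∫ s, clip u (g i x s) ∂(𝒟 i)‖ ≤ u ^ (1 - α) * (4 * (G ^ α + D ^ α)) := by
  obtain ⟨hI, hle⟩ := hg.integral_rpow_le hD (by linarith) h2 hG i x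
  -- By unbiasedness the bias is the mean of the pointwise clipping error.
  rw [← hg.unbiased i x, ← integral_sub (hg.integrable i x) (hg.integrable_clip hu.le i x)]
  calc ‖∫ s, (g i x s - clip u (g i x s)) ∂(𝒟 i)‖
      ≤ ∫ s, u ^ (1 - α) * ‖g i x s‖ ^ α ∂(𝒟 i) :=
        norm_integral_le_of_norm_le (hI.const_mul _)
          (Filter.Eventually.of_forall fun s => norm_sub_clip_le hu h1 _)
    _ ≤ u ^ (1 - α) * (4 * (G ^ α + D ^ α)) := by
        rw [integral_const_mul]
        gcongr

end Moments

/-! ### Pathwise bounds on drift, updates and staleness -/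

section Deterministic

variable {d : ℕ} {Z : Type*}

theorem localModel_sub (g : Vec d → Z → Vec d) (a u : ℝ) (x : Vec d) (z : ℕ → Z) (n : ℕ) :
    localModel g a u x z n - x = -(a • ∑ k ∈ Finset.range n, clippedGrad g a u x z k) := by
  induction n with
  | zero => simp [localModel]
  | succ n ih =>
    rw [Finset.sum_range_succ, smul_add, neg_add, ← ih]
    simp only [localModel, clippedGrad]
    abel

theorem norm_localModel_sub_le (g : Vec d → Z → Vec d) {a u : ℝ} (ha : 0 ≤ a) (hu : 0 ≤ u)
    (x : Vec d) (z : ℕ → Z) (n : ℕ) :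
    ‖localModel g a u x z n - x‖ ≤ n * (√d * (a * u)) := by
  rw [localModel_sub, norm_neg, norm_smul, Real.norm_of_nonneg ha]
  calc a * ‖∑ k ∈ Finset.range n, clippedGrad g a u x z k‖ ≤ a * (n * (√d * u)) := by
        gcongr
        refine (norm_sum_le_of_le _ fun k _ => norm_clip_le hu _).trans ?_
        simp
    _ = n * (√d * (a * u)) := by ring

theorem norm_hessProxy_le_sum (g : Vec d → Z → Vec d) (a u : ℝ) (x : Vec d) (z : ℕ → Z)
    (K : ℕ) : ‖hessProxy g a u x z K‖ ≤ a ^ 2 * ∑ k ∈ Finset.range K,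
      ‖hadamard (clippedGrad g a u x z k) (clippedGrad g a u x z k)‖ := by
  rw [Finset.mul_sum]
  refine norm_sum_le_of_le _ fun k _ => ?_
  rw [norm_smul, Real.norm_of_nonneg (sq_nonneg a)]

/-- This crude pathwise bound serves to show that global clipping is inactive. -/
theorem norm_compensated_le (g : Vec d → Z → Vec d) {a u : ℝ} (ha : 0 ≤ a) (hu : 0 ≤ u) (K : ℕ)
    (x y : Vec d) (z : ℕ → Z) :
    ‖compensated g a u K x y z‖ ≤
      K * (√d * (a * u)) + K * (√d * (a * u) ^ 2) * ‖x - y‖ := by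
  refine (norm_sub_le _ _).trans (add_le_add (norm_localModel_sub_le g ha hu y z K) ?_)
  refine (norm_hadamard_le _ _).trans ?_
  gcongr
  refine (norm_hessProxy_le_sum g a u y z K).trans ?_
  calc a ^ 2 * ∑ k ∈ Finset.range K,
        ‖hadamard (clippedGrad g a u y z k) (clippedGrad g a u y z k)‖
      ≤ a ^ 2 * ∑ _k ∈ Finset.range K, √d * (u * u) := by
        gcongr with k
        exact norm_hadamard_clip_le' hu _
    _ = K * (√d * (a * u) ^ 2) := by
        rw [Finset.sum_const, Finset.card_range, nsmul_eq_mul]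
        ring

/-- The squared clipped gradients stay as a sum because their mean is of order `u`, while the
pathwise bound is of order `u ^ 2`. -/
theorem inner_compensated_le (g : Vec d → Z → Vec d) (a u : ℝ) (K : ℕ)
    (x y : Vec d) (z : ℕ → Z) {v : Vec d} {G R : ℝ} (hv : ‖v‖ ≤ G) (hR : ‖x - y‖ ≤ R) :
    inner ℝ v (compensated g a u K x y z) ≤
      -(a * ∑ k ∈ Finset.range K, inner ℝ v (clippedGrad g a u y z k))
        + G * R * a ^ 2 * ∑ k ∈ Finset.range K,
          ‖hadamard (clippedGrad g a u y z k) (clippedGrad g a u y z k)‖ := by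
  have hG := (norm_nonneg _).trans hv
  have hR0 := (norm_nonneg _).trans hR
  have h1 : inner ℝ v (hadamard (hessProxy g a u y z K) (x - y)) ≥
      -(G * R * a ^ 2 * ∑ k ∈ Finset.range K,
          ‖hadamard (clippedGrad g a u y z k) (clippedGrad g a u y z k)‖) := by
    refine neg_le_of_abs_le ((abs_real_inner_le_norm _ _).trans ?_)
    calc ‖v‖ * ‖hadamard (hessProxy g a u y z K) (x - y)‖
        ≤ G * ((a ^ 2 * ∑ k ∈ Finset.range K,
          ‖hadamard (clippedGrad g a u y z k) (clippedGrad g a u y z k)‖) * R) := by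
          gcongr
          refine (norm_hadamard_le _ _).trans ?_
          gcongr
          exact norm_hessProxy_le_sum g a u y z K
      _ = _ := by ring
  unfold compensated
  rw [inner_sub_right, localModel_sub, inner_neg_right, inner_smul_right, inner_sum]
  linarith

/-- Global clipping caps every server step by `δ`, whatever the clients send. -/
theorem norm_globalModel_sub_le {N M : ℕ} (g : Fin N → Vec d → Z → Vec d) (h : Hyper)
    (S : Schedule N M) (K : ℕ) (x₀ : Vec d) (z : ℕ → Fin M → ℕ → Z) {T : ℕ} {δ : ℝ}
    (hδ : ∀ t ∈ Finset.Icc 1 T, 0 ≤ h.globalLR t ∧ 0 ≤ h.globalClip t ∧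
      √d * (h.globalLR t * h.globalClip t) ≤ δ) (s n : ℕ) (hn : s + n ≤ T) :
    ‖globalModel g h S K x₀ z (s + n) - globalModel g h S K x₀ z s‖ ≤ n * δ := by
  induction n with
  | zero => simp
  | succ n ih =>
    obtain ⟨h1, h2, h3⟩ := hδ (s + n + 1) (Finset.mem_Icc.2 ⟨by omega, hn⟩)
    have h4 := ih (by omega)
    rw [← add_assoc]
    simp only [globalModel]
    rw [add_sub_right_comm]
    refine (norm_add_le _ _).trans ?_
    push_cast
    rw [add_mul, one_mul]
    refine add_le_add h4 ?_
    rw [norm_smul, Real.norm_of_nonneg h1]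
    refine le_trans (mul_le_mul_of_nonneg_left (norm_clip_le h2 _) h1) ?_
    linarith

theorem Schedule.sub_le_maxDelay {N M : ℕ} (S : Schedule N M) {T t : ℕ}
    (ht : t ∈ Finset.Icc 1 T) (m : Fin M) : t - S.start t m ≤ S.maxDelay T :=
  Finset.le_sup (f := fun p : ℕ × Fin M => p.1 - S.start p.1 p.2) (b := (t, m))
    (Finset.mem_product.2 ⟨ht, Finset.mem_univ m⟩)

end Deterministic

/-! ### Expectations of clipped local gradients -/

section Expectation

variable {d N M K T : ℕ} {Ω Z : Type*} [MeasurableSpace Ω] [MeasurableSpace Z]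
  {P : Measure Ω} {𝒟 : Fin N → Measure Z}
  {g : Fin N → Vec d → Z → Vec d} {S : Schedule N M} {z : ℕ → Fin M → ℕ → Ω → Z}
  {F : Vec d → ℝ} {x₀ : Vec d} {α D G L L' Δ₀ μ r : ℝ}

theorem IsSampling.measurable_globalModel (hz : IsSampling P 𝒟 S K T z)
    (hg : IsHeavyTailed F g 𝒟 α D) (h : Hyper) (x₀ : Vec d) {t : ℕ} (ht : t ≤ T) :
    Measurable fun w => globalModel g h S K x₀ (fun t m k => z t m k w) t :=
  DelayComp.measurable_globalModel hg.meas h S K x₀ hz.meas ht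

theorem IsSampling.measurable_jobModel (hz : IsSampling P 𝒟 S K T z)
    (hg : IsHeavyTailed F g 𝒟 α D) (h : Hyper) (x₀ : Vec d) {t : ℕ} (ht : t < T) (m : Fin M)
    {k : ℕ} (hk : k ≤ K) :
    Measurable fun w => jobModel g h S K x₀ (fun t m k => z t m k w) (t + 1) m k := by
  refine DelayComp.measurable_jobModel hg.meas h S K x₀ (fun s hs => hz.meas s ?_) m
    fun i hi => hz.meas (t + 1) ?_ m i (by omega)
  · rw [Finset.mem_Icc] at hs ⊢
    omega
  · exact Finset.mem_Icc.2 ⟨by omega, ht⟩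

theorem IsSampling.measurable_jobClippedGrad (hz : IsSampling P 𝒟 S K T z)
    (hg : IsHeavyTailed F g 𝒟 α D) (h : Hyper) (x₀ : Vec d) {t : ℕ} (ht : t < T) (m : Fin M)
    {k : ℕ} (hk : k < K) :
    Measurable fun w => jobClippedGrad g h S K x₀ (fun t m k => z t m k w) (t + 1) m k :=
  (continuous_clip _).measurable.comp ((hg.meas _).comp
    ((hz.measurable_jobModel hg h x₀ ht m hk.le).prodMk
      (hz.meas (t + 1) (Finset.mem_Icc.2 ⟨by omega, ht⟩) m k hk)))

variable [IsProbabilityMeasure P]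

theorem IsSampling.integrable_norm_gradient_sq (hz : IsSampling P 𝒟 S K T z)
    (hg : IsHeavyTailed F g 𝒟 α D) (hO : IsObjective F x₀ G L L' Δ₀ μ r) (h : Hyper)
    {t : ℕ} (ht : t ≤ T) :
    Integrable (fun w => ‖gradient F
      (globalModel g h S K x₀ (fun t m k => z t m k w) t)‖ ^ 2) P := by
  have hm := (continuous_gradient (hO.contDiff.of_le (by norm_num))).measurable.comp
    (hz.measurable_globalModel hg h x₀ ht)
  refine Integrable.of_bound (hm.norm.pow_const 2).aestronglyMeasurable (G ^ 2)
    (Filter.Eventually.of_forall fun w => ?_)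
  rw [Real.norm_of_nonneg (by positivity)]
  exact pow_le_pow_left₀ (norm_nonneg _) (hO.grad_le _) 2

theorem IsSampling.integrable_inner_jobClippedGrad (hz : IsSampling P 𝒟 S K T z)
    (hg : IsHeavyTailed F g 𝒟 α D) (hO : IsObjective F x₀ G L L' Δ₀ μ r) (h : Hyper)
    {t : ℕ} (ht : t < T) (m : Fin M) {k : ℕ} (hk : k < K)
    (hu : 0 ≤ h.localClip (S.start (t + 1) m)) :
    Integrable (fun w => inner ℝ
      (gradient F (globalModel g h S K x₀ (fun t m k => z t m k w) t))
      (jobClippedGrad g h S K x₀ (fun t m k => z t m k w) (t + 1) m k)) P := by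
  have hm := (continuous_gradient (hO.contDiff.of_le (by norm_num))).measurable.comp
    (hz.measurable_globalModel hg h x₀ ht.le)
  refine Integrable.of_bound
    (hm.inner (hz.measurable_jobClippedGrad hg h x₀ ht m hk)).aestronglyMeasurable
    (G * (√d * h.localClip (S.start (t + 1) m))) (Filter.Eventually.of_forall fun w => ?_)
  exact (norm_inner_le_norm _ _).trans (mul_le_mul (hO.grad_le _) (norm_clip_le hu _)
    (norm_nonneg _) ((norm_nonneg _).trans (hO.grad_le x₀)))

theorem IsSampling.integrable_norm_hadamard_jobClippedGrad (hz : IsSampling P 𝒟 S K T z)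
    (hg : IsHeavyTailed F g 𝒟 α D) (h : Hyper) (x₀ : Vec d)
    {t : ℕ} (ht : t < T) (m : Fin M) {k : ℕ} (hk : k < K)
    (hu : 0 ≤ h.localClip (S.start (t + 1) m)) :
    Integrable (fun w => ‖hadamard
      (jobClippedGrad g h S K x₀ (fun t m k => z t m k w) (t + 1) m k)
      (jobClippedGrad g h S K x₀ (fun t m k => z t m k w) (t + 1) m k)‖) P := by
  have hm := hz.measurable_jobClippedGrad hg h x₀ ht m hk
  refine Integrable.of_bound
    (continuous_hadamard.measurable.comp (hm.prodMk hm)).norm.aestronglyMeasurable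
    (√d * (h.localClip (S.start (t + 1) m) * h.localClip (S.start (t + 1) m)))
    (Filter.Eventually.of_forall fun w => ?_)
  rw [norm_norm]
  exact norm_hadamard_clip_le' hu _

/-- A clipped local gradient correlates with the current global gradient, up to the clipping bias
and the distance between the two models. -/
theorem IsSampling.le_integral_inner_jobClippedGrad (hz : IsSampling P 𝒟 S K T z)
    (hg : IsHeavyTailed F g 𝒟 α D) (hO : IsObjective F x₀ G L L' Δ₀ μ r) (h : Hyper)
    (hD : 0 ≤ D) (h1 : 1 ≤ α) (h2 : α ≤ 2) {t : ℕ} (ht : t < T) (m : Fin M) {k : ℕ} (hk : k < K)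
    (hu : 0 < h.localClip (S.start (t + 1) m)) {R : ℝ}
    (hR : ∀ w, ‖jobModel g h S K x₀ (fun t m k => z t m k w) (t + 1) m k
      - globalModel g h S K x₀ (fun t m k => z t m k w) t‖ ≤ R) :
    (∫ w, ‖gradient F (globalModel g h S K x₀ (fun t m k => z t m k w) t)‖ ^ 2 ∂P)
        - G * (L * R + h.localClip (S.start (t + 1) m) ^ (1 - α) * (4 * (G ^ α + D ^ α)))
      ≤ ∫ w, inner ℝ (gradient F (globalModel g h S K x₀ (fun t m k => z t m k w) t))
        (jobClippedGrad g h S K x₀ (fun t m k => z t m k w) (t + 1) m k) ∂P := by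
  have hT : t + 1 ∈ Finset.Icc 1 T := Finset.mem_Icc.2 ⟨by omega, ht⟩
  set u := h.localClip (S.start (t + 1) m) with hu_def
  set i := S.client (t + 1) m with hi_def
  have := hg.prob i
  have hG0 : 0 ≤ G := (norm_nonneg _).trans (hO.grad_le x₀)
  have hL0 : 0 ≤ L := (norm_nonneg _).trans (hO.second_le x₀)
  have hcg : Continuous (gradient F) := continuous_gradient (hO.contDiff.of_le (by norm_num))
  let φ : (Vec d × Vec d) × Z → ℝ := fun p =>
    inner ℝ (gradient F p.1.1) (clip u (g i p.1.2 p.2))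
  have hφ : Measurable φ :=
    (hcg.measurable.comp (measurable_fst.comp measurable_fst)).inner
      ((continuous_clip u).measurable.comp ((hg.meas i).comp
        ((measurable_snd.comp measurable_fst).prodMk measurable_snd)))
  have hB : ∀ p, |φ p| ≤ G * (√d * u) := fun p =>
    (abs_real_inner_le_norm _ _).trans (mul_le_mul (hO.grad_le _) (norm_clip_le hu.le _)
      (norm_nonneg _) hG0)
  obtain ⟨hI, hE⟩ := integral_comp_prodMk_of_indepFun
    ((hz.measurable_globalModel hg h x₀ ht.le).prodMk (hz.measurable_jobModel hg h x₀ ht m hk.le))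
    (hz.meas (t + 1) hT m k hk) (hz.indepFun_models hg.meas h x₀ ht m hk)
    (hz.law (t + 1) hT m k hk) hφ hB
  have hV := hz.integrable_norm_gradient_sq hg hO h ht.le
  refine le_trans ?_ hE.ge
  have hsub : (∫ w, ‖gradient F (globalModel g h S K x₀ (fun t m k => z t m k w) t)‖ ^ 2 ∂P)
        - G * (L * R + u ^ (1 - α) * (4 * (G ^ α + D ^ α)))
      = ∫ w, (‖gradient F (globalModel g h S K x₀ (fun t m k => z t m k w) t)‖ ^ 2
        - G * (L * R + u ^ (1 - α) * (4 * (G ^ α + D ^ α)))) ∂P := by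
    rw [integral_sub hV (integrable_const _)]
    simp
  rw [hsub]
  refine integral_mono (hV.sub (integrable_const _)) hI fun w => ?_
  dsimp only [φ]
  set x := globalModel g h S K x₀ (fun t m k => z t m k w) t
  set y := jobModel g h S K x₀ (fun t m k => z t m k w) (t + 1) m k
  rw [integral_inner (hg.integrable_clip hu.le i y)]
  -- Through `gradient F y`: smoothness pays for the distance of the models, the rest is clipping
  -- bias at `y`.
  have hdiff : ‖gradient F x - ∫ s, clip u (g i y s) ∂(𝒟 i)‖
      ≤ L * R + u ^ (1 - α) * (4 * (G ^ α + D ^ α)) := by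
    refine (norm_sub_le_norm_sub_add_norm_sub _ (gradient F y) _).trans (add_le_add ?_
      (hg.norm_gradient_sub_integral_clip_le hD h1 h2 hO.grad_le hu i y))
    refine (norm_gradient_sub_le (hO.contDiff.of_le (by norm_num)) hO.second_le y x).trans ?_
    gcongr
    rw [norm_sub_rev]
    exact hR w
  have hin : inner ℝ (gradient F x) (gradient F x - ∫ s, clip u (g i y s) ∂(𝒟 i))
      ≤ G * (L * R + u ^ (1 - α) * (4 * (G ^ α + D ^ α))) :=
    (real_inner_le_norm _ _).trans (mul_le_mul (hO.grad_le x) hdiff (norm_nonneg _) hG0)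
  rw [inner_sub_right, real_inner_self_eq_norm_sq] at hin
  linarith

theorem IsSampling.integral_norm_hadamard_jobClippedGrad_le (hz : IsSampling P 𝒟 S K T z)
    (hg : IsHeavyTailed F g 𝒟 α D) (hG : ∀ x, ‖gradient F x‖ ≤ G) (h : Hyper) (x₀ : Vec d)
    (hD : 0 ≤ D) (h1 : 1 ≤ α) (h2 : α ≤ 2) {t : ℕ} (ht : t < T) (m : Fin M) {k : ℕ} (hk : k < K)
    (hu : 0 ≤ h.localClip (S.start (t + 1) m)) :
    ∫ w, ‖hadamard (jobClippedGrad g h S K x₀ (fun t m k => z t m k w) (t + 1) m k)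
        (jobClippedGrad g h S K x₀ (fun t m k => z t m k w) (t + 1) m k)‖ ∂P
      ≤ h.localClip (S.start (t + 1) m) * (4 * (G ^ α + D ^ α) + 1) := by
  have hT : t + 1 ∈ Finset.Icc 1 T := Finset.mem_Icc.2 ⟨by omega, ht⟩
  set u := h.localClip (S.start (t + 1) m) with hu_def
  set i := S.client (t + 1) m with hi_def
  have := hg.prob i
  let φ : (Vec d × Vec d) × Z → ℝ := fun p =>
    ‖hadamard (clip u (g i p.1.2 p.2)) (clip u (g i p.1.2 p.2))‖
  have hc : Measurable fun p : (Vec d × Vec d) × Z => clip u (g i p.1.2 p.2) :=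
    (continuous_clip u).measurable.comp ((hg.meas i).comp
        ((measurable_snd.comp measurable_fst).prodMk measurable_snd))
  have hφ : Measurable φ := (continuous_hadamard.measurable.comp (hc.prodMk hc)).norm
  have hB : ∀ p, |φ p| ≤ √d * (u * u) := fun p => by
    rw [abs_norm]
    exact norm_hadamard_clip_le' hu _
  obtain ⟨hI, hE⟩ := integral_comp_prodMk_of_indepFun
    ((hz.measurable_globalModel hg h x₀ ht.le).prodMk (hz.measurable_jobModel hg h x₀ ht m hk.le))
    (hz.meas (t + 1) hT m k hk) (hz.indepFun_models hg.meas h x₀ ht m hk)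
    (hz.law (t + 1) hT m k hk) hφ hB
  refine hE.le.trans ?_
  calc _ ≤ ∫ _w, u * (4 * (G ^ α + D ^ α) + 1) ∂P := by
        refine integral_mono hI (integrable_const _) fun w => ?_
        dsimp only [φ]
        set y := jobModel g h S K x₀ (fun t m k => z t m k w) (t + 1) m k
        calc _ ≤ ∫ s, u * ‖g i y s‖ ∂(𝒟 i) :=
              integral_mono_of_nonneg (Filter.Eventually.of_forall fun s => norm_nonneg _)
                ((hg.integrable i y).norm.const_mul u)
                (Filter.Eventually.of_forall fun s => norm_hadamard_clip_le hu _)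
          _ ≤ u * (4 * (G ^ α + D ^ α) + 1) := by
              rw [integral_const_mul]
              gcongr
              exact hg.integral_norm_le hD h1 h2 hG i y
    _ = _ := by simp

end Expectation

/-! ### One server step -/

section Step

variable {d N M : ℕ} {Z : Type*} {F : Vec d → ℝ} {x₀ : Vec d} {G L L' Δ₀ μ r : ℝ}

/-- The contribution of one client update aggregated at round `t + 1`. -/
noncomputable abbrev jobUpdate (g : Fin N → Vec d → Z → Vec d) (h : Hyper) (S : Schedule N M) (K : ℕ)
    (x₀ : Vec d) (z : ℕ → Fin M → ℕ → Z) (t : ℕ) (m : Fin M) : Vec d :=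
  compensated (g (S.client (t + 1) m)) (h.localLR (S.start (t + 1) m))
    (h.localClip (S.start (t + 1) m)) K (globalModel g h S K x₀ z t)
    (globalModel g h S K x₀ z (S.start (t + 1) m)) (z (t + 1) m)

/-- One server step decreases the objective along the aggregated update when the global clipping
is inactive. -/
theorem IsObjective.globalModel_succ_le (hO : IsObjective F x₀ G L L' Δ₀ μ r)
    (g : Fin N → Vec d → Z → Vec d) (h : Hyper) (S : Schedule N M) (K : ℕ)
    (z : ℕ → Fin M → ℕ → Z) {t : ℕ} {B : ℝ} (hM : 1 ≤ M)
    (hη : 0 ≤ h.globalLR (t + 1)) (hclip : B ≤ h.globalClip (t + 1))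
    (hB : ∀ m, ‖jobUpdate g h S K x₀ z t m‖ ≤ B) :
    F (globalModel g h S K x₀ z (t + 1)) - F (globalModel g h S K x₀ z t) ≤
      h.globalLR (t + 1) * ((M : ℝ)⁻¹ * ∑ m, inner ℝ (gradient F (globalModel g h S K x₀ z t))
        (jobUpdate g h S K x₀ z t m)) + L * (h.globalLR (t + 1) * B) ^ 2 := by
  have hL0 : 0 ≤ L := (norm_nonneg _).trans (hO.second_le x₀)
  have hM' : (0 : ℝ) < M := by exact_mod_cast hM
  have hnorm : ‖(M : ℝ)⁻¹ • ∑ m, jobUpdate g h S K x₀ z t m‖ ≤ B := by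
    rw [norm_smul, Real.norm_of_nonneg (by positivity), inv_mul_le_iff₀ hM']
    refine (norm_sum_le_of_le _ fun m _ => hB m).trans ?_
    simp
  have hstep : globalModel g h S K x₀ z (t + 1) - globalModel g h S K x₀ z t
      = h.globalLR (t + 1) • ((M : ℝ)⁻¹ • ∑ m, jobUpdate g h S K x₀ z t m) := by
    rw [← clip_eq_self (hnorm.trans hclip)]
    simp only [globalModel, add_sub_cancel_left]
  refine (sub_le_inner_gradient_add (hO.contDiff.of_le (by norm_num)) hO.second_le
    (globalModel g h S K x₀ z t) (globalModel g h S K x₀ z (t + 1))).trans ?_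
  rw [hstep, inner_smul_right, inner_smul_right, inner_sum, norm_smul, Real.norm_of_nonneg hη]
  gcongr

end Step

/-! ### Summing the descent over the rounds -/

section Descent

variable {d N M K T : ℕ} {Ω Z : Type*} [MeasurableSpace Ω] [MeasurableSpace Z]
  {P : Measure Ω} [IsProbabilityMeasure P] {𝒟 : Fin N → Measure Z}
  {g : Fin N → Vec d → Z → Vec d} {S : Schedule N M} {z : ℕ → Fin M → ℕ → Ω → Z}
  {F : Vec d → ℝ} {x₀ : Vec d} {α D G L L' Δ₀ μ r : ℝ}

theorem IsSampling.integral_inner_jobUpdate_le (hz : IsSampling P 𝒟 S K T z)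
    (hg : IsHeavyTailed F g 𝒟 α D) (hO : IsObjective F x₀ G L L' Δ₀ μ r) (h : Hyper)
    (hD : 0 ≤ D) (h1 : 1 ≤ α) (h2 : α ≤ 2) {t : ℕ} (ht : t < T) (m : Fin M)
    (ha : 0 ≤ h.localLR (S.start (t + 1) m)) (hu : 0 < h.localClip (S.start (t + 1) m))
    {R R' : ℝ}
    (hR : ∀ k < K, ∀ w, ‖jobModel g h S K x₀ (fun t m k => z t m k w) (t + 1) m k
      - globalModel g h S K x₀ (fun t m k => z t m k w) t‖ ≤ R)
    (hR' : ∀ w, ‖globalModel g h S K x₀ (fun t m k => z t m k w) t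
      - globalModel g h S K x₀ (fun t m k => z t m k w) (S.start (t + 1) m)‖ ≤ R') :
    Integrable (fun w => inner ℝ
        (gradient F (globalModel g h S K x₀ (fun t m k => z t m k w) t))
        (jobUpdate g h S K x₀ (fun t m k => z t m k w) t m)) P ∧
      ∫ w, inner ℝ (gradient F (globalModel g h S K x₀ (fun t m k => z t m k w) t))
        (jobUpdate g h S K x₀ (fun t m k => z t m k w) t m) ∂P ≤
      -(h.localLR (S.start (t + 1) m) * (K *
        ((∫ w, ‖gradient F (globalModel g h S K x₀ (fun t m k => z t m k w) t)‖ ^ 2 ∂P)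
        - G * (L * R + h.localClip (S.start (t + 1) m) ^ (1 - α) * (4 * (G ^ α + D ^ α))))))
      + G * R' * h.localLR (S.start (t + 1) m) ^ 2 * (K *
        (h.localClip (S.start (t + 1) m) * (4 * (G ^ α + D ^ α) + 1))) := by
  set u := h.localClip (S.start (t + 1) m) with hu_def
  set a := h.localLR (S.start (t + 1) m) with ha_def
  have hG0 : 0 ≤ G := (norm_nonneg _).trans (hO.grad_le x₀)
  obtain ⟨w₀⟩ : Nonempty Ω := nonempty_of_isProbabilityMeasure P
  have hR0 : 0 ≤ R' := (norm_nonneg _).trans (hR' w₀)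
  let p : ℕ → Ω → ℝ := fun k w =>
    inner ℝ (gradient F (globalModel g h S K x₀ (fun t m k => z t m k w) t))
      (jobClippedGrad g h S K x₀ (fun t m k => z t m k w) (t + 1) m k)
  let q : ℕ → Ω → ℝ := fun k w =>
    ‖hadamard (jobClippedGrad g h S K x₀ (fun t m k => z t m k w) (t + 1) m k)
      (jobClippedGrad g h S K x₀ (fun t m k => z t m k w) (t + 1) m k)‖
  have hp : ∀ k ∈ Finset.range K, Integrable (p k) P := fun k hk =>
    hz.integrable_inner_jobClippedGrad hg hO h ht m (Finset.mem_range.1 hk) hu.le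
  have hq : ∀ k ∈ Finset.range K, Integrable (q k) P := fun k hk =>
    hz.integrable_norm_hadamard_jobClippedGrad hg h x₀ ht m (Finset.mem_range.1 hk) hu.le
  have hle : ∀ w, inner ℝ (gradient F (globalModel g h S K x₀ (fun t m k => z t m k w) t))
        (jobUpdate g h S K x₀ (fun t m k => z t m k w) t m) ≤
      -(a * ∑ k ∈ Finset.range K, p k w) + G * R' * a ^ 2 * ∑ k ∈ Finset.range K, q k w :=
    fun w => inner_compensated_le _ a u K _ _ _ (hO.grad_le _) (hR' w)
  have hP : Integrable (fun w => -(a * ∑ k ∈ Finset.range K, p k w)) P :=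
    ((integrable_finsetSum _ hp).const_mul a).neg
  have hQ : Integrable (fun w => G * R' * a ^ 2 * ∑ k ∈ Finset.range K, q k w) P :=
    (integrable_finsetSum _ hq).const_mul _
  have hI : Integrable (fun w => inner ℝ
        (gradient F (globalModel g h S K x₀ (fun t m k => z t m k w) t))
        (jobUpdate g h S K x₀ (fun t m k => z t m k w) t m)) P := by
    have hx := hz.measurable_globalModel hg h x₀ ht.le
    have hs := S.start_lt t m
    refine Integrable.of_bound
      (((continuous_gradient (hO.contDiff.of_le (by norm_num))).measurable.comp hx).inner
        (measurable_compensated (hg.meas _) a u hx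
          (hz.measurable_globalModel hg h x₀ (t := S.start (t + 1) m) (by omega))
          (hz.meas (t + 1) (Finset.mem_Icc.2 ⟨by omega, ht⟩) m))).aestronglyMeasurable
      (G * (K * (√d * (a * u)) + K * (√d * (a * u) ^ 2) * R'))
      (Filter.Eventually.of_forall fun w => ?_)
    refine (norm_inner_le_norm _ _).trans (mul_le_mul (hO.grad_le _)
      ((norm_compensated_le _ ha hu.le K _ _ _).trans ?_) (norm_nonneg _) hG0)
    gcongr
    exact hR' w
  refine ⟨hI, (integral_mono hI (hP.add hQ) hle).trans ?_⟩
  rw [integral_add' hP hQ, integral_neg, integral_const_mul, integral_const_mul,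
    integral_finsetSum _ hp, integral_finsetSum _ hq]
  refine add_le_add (neg_le_neg ?_) ?_
  · gcongr
    rw [← nsmul_eq_mul, ← Finset.card_range K, ← Finset.sum_const, Finset.card_range]
    exact Finset.sum_le_sum fun k hk => hz.le_integral_inner_jobClippedGrad hg hO h hD h1 h2 ht m
      (Finset.mem_range.1 hk) hu (hR k (Finset.mem_range.1 hk))
  · gcongr
    rw [← nsmul_eq_mul, ← Finset.card_range K, ← Finset.sum_const, Finset.card_range]
    exact Finset.sum_le_sum fun k hk => hz.integral_norm_hadamard_jobClippedGrad_le hg hO.grad_le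
      h x₀ hD h1 h2 ht m (Finset.mem_range.1 hk) hu.le

/-- The convergence bound for step sizes and thresholds proportional to `e`, `n` and `y`, in terms
of the rate `ρ` that these determine. -/
theorem exists_integral_norm_gradient_sq_le (hM : 1 ≤ M) (hK : 1 ≤ K)
    (hz : IsSampling P 𝒟 S K T z)
    (hg : IsHeavyTailed F g 𝒟 α D) (hO : IsObjective F x₀ G L L' Δ₀ μ r) (h : Hyper)
    (hD : 0 ≤ D) (h1 : 1 ≤ α) (h2 : α ≤ 2) (hT : 1 ≤ T) {c c' cτ e n y ρ C : ℝ}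
    (hc : 0 < c) (hc' : 0 < c') (hcτ : 0 ≤ cτ) (he : 0 < e) (hn : 0 < n) (hy : 0 < y)
    (hρ : 0 < ρ) (hρ1 : ρ ≤ 1) (hny : n * y = ρ) (hyα : y ^ (1 - α) = ρ)
    (hTe : T * e ^ 2 = 1) (hTρ : T * (e * n) * ρ = 1)
    (hglobalLR : ∀ t ∈ Finset.Icc 1 T, c * e ≤ h.globalLR t ∧ h.globalLR t ≤ c' * e)
    (hlocalLR : ∀ s < T, c * n ≤ h.localLR s ∧ h.localLR s ≤ c' * n)
    (hlocalClip : ∀ s < T, c * y ≤ h.localClip s ∧ h.localClip s ≤ c' * y)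
    (hglobalClip : ∀ t ∈ Finset.Icc 1 T, c ≤ h.globalClip t ∧ h.globalClip t ≤ c')
    (hτ : (S.maxDelay T : ℝ) * e ≤ cτ * ρ) {H B E : ℝ}
    (hH : H = √d * c' ^ 2) (hB : B = K * H * (1 + √d * c' ^ 4 * cτ))
    (hE : E = G * (L * (K * H + cτ * H) + c ^ (1 - α) * (4 * (G ^ α + D ^ α)))
      + c' ^ 2 * (4 * (G ^ α + D ^ α) + 1) * (G * (cτ * H)))
    (hC₁ : E + (Δ₀ + L * c' ^ 2 * B ^ 2 + 1) / (c ^ 2 * K) ≤ C) (hC₂ : G ^ 2 * B / c ≤ C) :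
    ∃ t ∈ Finset.Icc 1 T, ∫ w, ‖gradient F
      (globalModel g h S K x₀ (fun t m k => z t m k w) (t - 1))‖ ^ 2 ∂P ≤ C * ρ := by
  have hG0 : 0 ≤ G := (norm_nonneg _).trans (hO.grad_le x₀)
  have hL0 : 0 ≤ L := (norm_nonneg _).trans (hO.second_le x₀)
  have hΔ0 : 0 ≤ Δ₀ := by simpa using hO.gap_le x₀
  have hH0 : 0 ≤ H := hH ▸ by positivity
  have hB0 : 0 ≤ B := hB ▸ by positivity
  have hK' : (1 : ℝ) ≤ K := by exact_mod_cast hK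
  have hM' : (0 : ℝ) < M := by exact_mod_cast hM
  -- `B * ρ` bounds the aggregated update and `c` is the least global threshold. If `B * ρ > c`,
  -- then `ρ` is bounded below and the bound `G ^ 2` is already of order `ρ`.
  rcases le_or_gt (B * ρ) c with hBc | hBc
  swap
  · refine ⟨1, Finset.mem_Icc.2 ⟨le_rfl, hT⟩, ?_⟩
    calc ∫ w, ‖gradient F (globalModel g h S K x₀ (fun t m k => z t m k w) (1 - 1))‖ ^ 2 ∂P
        ≤ ∫ _w, G ^ 2 ∂P := integral_mono_of_nonneg
          (Filter.Eventually.of_forall fun w => by positivity) (integrable_const _)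
          (Filter.Eventually.of_forall fun w =>
            pow_le_pow_left₀ (norm_nonneg _) (hO.grad_le _) 2)
      _ = G ^ 2 * c / c := by
          rw [mul_div_cancel_right₀ _ hc.ne']
          simp
      _ ≤ G ^ 2 * (B * ρ) / c := by gcongr
      _ = G ^ 2 * B / c * ρ := by ring
      _ ≤ C * ρ := by gcongr
  by_contra hcon
  push Not at hcon
  have hIcc : ∀ t < T, t + 1 ∈ Finset.Icc 1 T := fun t ht =>
    Finset.mem_Icc.2 ⟨by omega, ht⟩
  have hstart : ∀ t < T, ∀ m, S.start (t + 1) m < T := fun t ht m =>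
    (S.start_lt t m).trans_le ht
  have ha : ∀ s < T, 0 < h.localLR s := fun s hs =>
    (mul_pos hc hn).trans_le (hlocalLR s hs).1
  have hu : ∀ s < T, 0 < h.localClip s := fun s hs =>
    (mul_pos hc hy).trans_le (hlocalClip s hs).1
  have hη : ∀ t ∈ Finset.Icc 1 T, 0 < h.globalLR t := fun t ht =>
    (mul_pos hc he).trans_le (hglobalLR t ht).1
  have hau : ∀ s < T, h.localLR s * h.localClip s ≤ c' ^ 2 * ρ := fun s hs => by
    calc h.localLR s * h.localClip s ≤ (c' * n) * (c' * y) :=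
          mul_le_mul (hlocalLR s hs).2 (hlocalClip s hs).2 (hu s hs).le (by positivity)
      _ = c' ^ 2 * ρ := by rw [← hny]; ring
  have hlocal : ∀ t < T, ∀ m, ∀ k < K, ∀ w,
      ‖jobModel g h S K x₀ (fun t m k => z t m k w) (t + 1) m k
        - globalModel g h S K x₀ (fun t m k => z t m k w) (S.start (t + 1) m)‖
        ≤ K * H * ρ := fun t ht m k hk w => by
    have hs := hstart t ht m
    refine (norm_localModel_sub_le _ (ha _ hs).le (hu _ hs).le _ _ k).trans ?_
    calc (k : ℝ) * (√d * (h.localLR (S.start (t + 1) m) * h.localClip (S.start (t + 1) m)))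
        ≤ K * (√d * (c' ^ 2 * ρ)) := by
          have hk' : (k : ℝ) ≤ K := by exact_mod_cast hk.le
          have := mul_pos (ha _ hs) (hu _ hs)
          have := hau _ hs
          gcongr
      _ = K * H * ρ := by rw [hH]; ring
  have hstale : ∀ t < T, ∀ m, ∀ w,
      ‖globalModel g h S K x₀ (fun t m k => z t m k w) t
        - globalModel g h S K x₀ (fun t m k => z t m k w) (S.start (t + 1) m)‖
        ≤ cτ * H * ρ := fun t ht m w => by
    have hs := S.start_lt t m
    have hdelay := S.sub_le_maxDelay (hIcc t ht) m
    have hδ : ∀ t ∈ Finset.Icc 1 T, 0 ≤ h.globalLR t ∧ 0 ≤ h.globalClip t ∧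
        √d * (h.globalLR t * h.globalClip t) ≤ √d * ((c' * e) * c') := fun t ht => by
      have h0 := hc.trans_le (hglobalClip t ht).1
      refine ⟨(hη t ht).le, h0.le, ?_⟩
      gcongr
      · exact (hglobalLR t ht).2
      · exact (hglobalClip t ht).2
    have hmove := norm_globalModel_sub_le g h S K x₀ (fun t m k => z t m k w) hδ
      (S.start (t + 1) m) (t - S.start (t + 1) m) (by omega)
    rw [Nat.add_sub_cancel' (by omega)] at hmove
    refine hmove.trans ?_
    calc ((t - S.start (t + 1) m : ℕ) : ℝ) * (√d * ((c' * e) * c'))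
        ≤ (S.maxDelay T : ℝ) * (√d * ((c' * e) * c')) := by
          gcongr
          omega
      _ = H * ((S.maxDelay T : ℝ) * e) := by rw [hH]; ring
      _ ≤ H * (cτ * ρ) := by gcongr
      _ = cτ * H * ρ := by ring
  have hupdate : ∀ t < T, ∀ m, ∀ w,
      ‖jobUpdate g h S K x₀ (fun t m k => z t m k w) t m‖ ≤ B * ρ := fun t ht m w => by
    have hs := hstart t ht m
    have hau' := hau _ hs
    have hau0 := mul_pos (ha _ hs) (hu _ hs)
    refine (norm_compensated_le _ (ha _ hs).le (hu _ hs).le K _ _ _).trans ?_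
    calc _ ≤ K * (√d * (c' ^ 2 * ρ)) + K * (√d * (c' ^ 2 * ρ) ^ 2) * (cτ * H * ρ) := by
          have := hstale t ht m w
          gcongr
      _ = K * H * ρ + K * H * (√d * c' ^ 4 * cτ) * ρ ^ 3 := by rw [hH]; ring
      _ ≤ K * H * ρ + K * H * (√d * c' ^ 4 * cτ) * ρ := by
          gcongr
          exact pow_le_of_le_one hρ.le hρ1 (by norm_num)
      _ = B * ρ := by rw [hB]; ring
  -- The `+ 1` in the lower bound for `C` makes this strict.
  have hCE : 0 < C - E := by
    have : 0 < (Δ₀ + L * c' ^ 2 * B ^ 2 + 1) / (c ^ 2 * K) := by positivity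
    linarith
  have hjob : ∀ t < T, ∀ m, Integrable (fun w => inner ℝ
        (gradient F (globalModel g h S K x₀ (fun t m k => z t m k w) t))
        (jobUpdate g h S K x₀ (fun t m k => z t m k w) t m)) P ∧
      ∫ w, inner ℝ (gradient F (globalModel g h S K x₀ (fun t m k => z t m k w) t))
        (jobUpdate g h S K x₀ (fun t m k => z t m k w) t m) ∂P ≤
      -(c * n * (K * ((C - E) * ρ))) := fun t ht m => by
    have hs := hstart t ht m
    obtain ⟨hI, hle⟩ := hz.integral_inner_jobUpdate_le hg hO h hD h1 h2 ht m (ha _ hs).le (hu _ hs)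
      (R := K * H * ρ + cτ * H * ρ) (R' := cτ * H * ρ) (fun k hk w => by
        rw [← sub_add_sub_cancel _
          (globalModel g h S K x₀ (fun t m k => z t m k w) (S.start (t + 1) m))]
        refine (norm_add_le _ _).trans (add_le_add (hlocal t ht m k hk w) ?_)
        rw [norm_sub_rev]
        exact hstale t ht m w) (hstale t ht m)
    refine ⟨hI, hle.trans ?_⟩
    have hlow := (hlocalLR _ hs).1
    have hau' := hau _ hs
    have ha' := ha _ hs
    have hV := hcon (t + 1) (hIcc t ht)
    rw [Nat.add_sub_cancel] at hV
    -- The exponent `1 - α` is nonpositive, so the lower bound on the threshold is the relevant one.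
    have hbias : h.localClip (S.start (t + 1) m) ^ (1 - α) ≤ c ^ (1 - α) * ρ := by
      rw [← hyα, ← Real.mul_rpow hc.le hy.le]
      exact Real.rpow_le_rpow_of_nonpos (mul_pos hc hy) (hlocalClip _ hs).1 (by linarith)
    set a := h.localLR (S.start (t + 1) m)
    set u := h.localClip (S.start (t + 1) m)
    set V := ∫ w, ‖gradient F (globalModel g h S K x₀ (fun t m k => z t m k w) t)‖ ^ 2 ∂P
    set b := 4 * (G ^ α + D ^ α) with hb
    have hb0 : 0 ≤ b := by positivity
    have hau1 : a * u ≤ c' ^ 2 := hau'.trans (mul_le_of_le_one_right (by positivity) hρ1)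
    have e1 : G * (L * (K * H * ρ + cτ * H * ρ) + u ^ (1 - α) * b)
        ≤ G * (L * (K * H + cτ * H) + c ^ (1 - α) * b) * ρ := by
      calc G * (L * (K * H * ρ + cτ * H * ρ) + u ^ (1 - α) * b)
          ≤ G * (L * (K * H * ρ + cτ * H * ρ) + c ^ (1 - α) * ρ * b) := by gcongr
        _ = _ := by ring
    have e2 : G * (cτ * H * ρ) * a ^ 2 * (K * (u * (b + 1)))
        ≤ a * (K * (c' ^ 2 * (b + 1) * (G * (cτ * H)) * ρ)) := by
      calc G * (cτ * H * ρ) * a ^ 2 * (K * (u * (b + 1)))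
          = G * (cτ * H * ρ) * a * (K * ((a * u) * (b + 1))) := by ring
        _ ≤ G * (cτ * H * ρ) * a * (K * (c' ^ 2 * (b + 1))) := by gcongr
        _ = _ := by ring
    -- `E * ρ` collects the drift, staleness and bias (`e1`) and the compensation (`e2`); since `V >
    -- C * ρ`, a net gain `(C - E) * ρ` remains.
    have e3 : (C - E) * ρ + c' ^ 2 * (b + 1) * (G * (cτ * H)) * ρ ≤
        V - G * (L * (K * H * ρ + cτ * H * ρ) + u ^ (1 - α) * b) := by
      rw [hE]
      linarith
    have e4 : a * (K * ((C - E) * ρ + c' ^ 2 * (b + 1) * (G * (cτ * H)) * ρ)) ≤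
        a * (K * (V - G * (L * (K * H * ρ + cτ * H * ρ) + u ^ (1 - α) * b))) := by gcongr
    have e5 : c * n * (K * ((C - E) * ρ)) ≤ a * (K * ((C - E) * ρ)) := by gcongr
    linarith
  let I : ℕ → Fin M → Ω → ℝ := fun t m w =>
    inner ℝ (gradient F (globalModel g h S K x₀ (fun t m k => z t m k w) t))
      (jobUpdate g h S K x₀ (fun t m k => z t m k w) t m)
  have hpoint : ∀ w, -Δ₀ ≤ ∑ t ∈ Finset.range T,
      (h.globalLR (t + 1) * ((M : ℝ)⁻¹ * ∑ m, I t m w) + L * (c' * e * (B * ρ)) ^ 2) := by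
    intro w
    have h0 := hO.gap_le (globalModel g h S K x₀ (fun t m k => z t m k w) T)
    have hsum := Finset.sum_range_sub
      (fun t => F (globalModel g h S K x₀ (fun t m k => z t m k w) t)) T
    have hx0 : globalModel g h S K x₀ (fun t m k => z t m k w) 0 = x₀ := by simp only [globalModel]
    rw [hx0] at hsum
    have hle : ∑ t ∈ Finset.range T,
        (F (globalModel g h S K x₀ (fun t m k => z t m k w) (t + 1))
          - F (globalModel g h S K x₀ (fun t m k => z t m k w) t)) ≤ ∑ t ∈ Finset.range T,
        (h.globalLR (t + 1) * ((M : ℝ)⁻¹ * ∑ m, I t m w) + L * (c' * e * (B * ρ)) ^ 2) := by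
      refine Finset.sum_le_sum fun t ht => ?_
      have ht' := Finset.mem_range.1 ht
      have hη' := hη _ (hIcc t ht')
      refine (hO.globalModel_succ_le g h S K (fun t m k => z t m k w) hM hη'.le
        (hBc.trans (hglobalClip _ (hIcc t ht')).1) (fun m => hupdate t ht' m w)).trans ?_
      have := (hglobalLR _ (hIcc t ht')).2
      gcongr
    linarith
  have hint : ∀ t ∈ Finset.range T, Integrable (fun w =>
      h.globalLR (t + 1) * ((M : ℝ)⁻¹ * ∑ m, I t m w) + L * (c' * e * (B * ρ)) ^ 2) P :=
    fun t ht => (((integrable_finsetSum _ fun m _ =>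
      (hjob t (Finset.mem_range.1 ht) m).1).const_mul _).const_mul _).add (integrable_const _)
  have hmean : ∀ t ∈ Finset.range T, ∫ w, (h.globalLR (t + 1) * ((M : ℝ)⁻¹ * ∑ m, I t m w)
      + L * (c' * e * (B * ρ)) ^ 2) ∂P ≤
      -(c * e * (c * n * (K * ((C - E) * ρ)))) + L * (c' * e * (B * ρ)) ^ 2 := by
    intro t ht
    have ht' := Finset.mem_range.1 ht
    have hsumI : Integrable (fun w => ∑ m, I t m w) P :=
      integrable_finsetSum _ fun m _ => (hjob t ht' m).1
    rw [integral_add ((hsumI.const_mul _).const_mul _) (integrable_const _), integral_const_mul,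
      integral_const_mul, integral_finsetSum _ fun m _ => (hjob t ht' m).1]
    simp only [integral_const, probReal_univ, one_smul]
    gcongr
    have hs : ∑ m, ∫ w, I t m w ∂P ≤ M * -(c * n * (K * ((C - E) * ρ))) := by
      refine (Finset.sum_le_sum fun m _ => (hjob t ht' m).2).trans ?_
      simp
    have hs' : (M : ℝ)⁻¹ * ∑ m, ∫ w, I t m w ∂P ≤ -(c * n * (K * ((C - E) * ρ))) :=
      (inv_mul_le_iff₀ hM').2 hs
    have hηlow := (hglobalLR _ (hIcc t ht')).1
    calc h.globalLR (t + 1) * ((M : ℝ)⁻¹ * ∑ m, ∫ w, I t m w ∂P)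
        ≤ h.globalLR (t + 1) * -(c * n * (K * ((C - E) * ρ))) :=
          mul_le_mul_of_nonneg_left hs' (hη _ (hIcc t ht')).le
      _ ≤ -(c * e * (c * n * (K * ((C - E) * ρ)))) := by
          rw [mul_neg]
          gcongr
  have htotal : -Δ₀ ≤ T * (-(c * e * (c * n * (K * ((C - E) * ρ))))
      + L * (c' * e * (B * ρ)) ^ 2) := by
    calc -Δ₀ = ∫ _w, -Δ₀ ∂P := by simp
      _ ≤ ∫ w, ∑ t ∈ Finset.range T, (h.globalLR (t + 1) * ((M : ℝ)⁻¹ * ∑ m, I t m w)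
          + L * (c' * e * (B * ρ)) ^ 2) ∂P :=
        integral_mono (integrable_const _) (integrable_finsetSum _ hint) hpoint
      _ ≤ _ := by
        rw [integral_finsetSum _ hint]
        refine (Finset.sum_le_sum hmean).trans ?_
        rw [Finset.sum_const, Finset.card_range, nsmul_eq_mul]
  -- The two rate identities remove `T`: the total gain is a constant multiple of `C - E`, the total
  -- second-order loss is of order `ρ ^ 2`.
  have hsplit : T * (-(c * e * (c * n * (K * ((C - E) * ρ)))) + L * (c' * e * (B * ρ)) ^ 2)
      = -(c ^ 2 * K * (C - E)) + L * c' ^ 2 * B ^ 2 * ρ ^ 2 := by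
    calc _ = -(c ^ 2 * K * (C - E) * (T * (e * n) * ρ))
          + L * c' ^ 2 * B ^ 2 * ρ ^ 2 * (T * e ^ 2) := by ring
      _ = _ := by rw [hTe, hTρ, mul_one, mul_one]
  have hρ2 : L * c' ^ 2 * B ^ 2 * ρ ^ 2 ≤ L * c' ^ 2 * B ^ 2 :=
    mul_le_of_le_one_right (by positivity) (pow_le_one₀ hρ.le hρ1)
  have hCE' : Δ₀ + L * c' ^ 2 * B ^ 2 + 1 ≤ c ^ 2 * K * (C - E) := by
    have h3 : (Δ₀ + L * c' ^ 2 * B ^ 2 + 1) / (c ^ 2 * K) ≤ C - E := by linarith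
    rw [div_le_iff₀ (by positivity)] at h3
    linarith
  linarith

end Descent

end DelayComp

/-! ### The exponents of the theorem -/

theorem theorem3
    (d N M K : ℕ) (hM : 1 ≤ M) (hK : 1 ≤ K)
    (α D : ℝ) (hα₁ : 1 < α) (hα₂ : α < 2) (hD : 0 < D)
    (G L L' Δ₀ μ r : ℝ) (hμ : 0 < μ) (hr : 0 < r)
    (B₁ B₂ c c' cτ : ℝ) (hc : 0 < c) :
    ∃ C : ℝ, 0 < C ∧
      ∀ (Ω Z : Type*) [MeasurableSpace Ω] [MeasurableSpace Z]
        (P : Measure Ω) [IsProbabilityMeasure P]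
        (F : Vec d → ℝ) (x₀ : Vec d)
        (g : Fin N → Vec d → Z → Vec d) (𝒟 : Fin N → Measure Z)
        (T : ℕ) (h : DelayComp.Hyper) (S : DelayComp.Schedule N M)
        (z : ℕ → Fin M → ℕ → Ω → Z),
        1 ≤ T →
        DelayComp.IsObjective F x₀ G L L' Δ₀ μ r →
        DelayComp.IsHeavyTailed F g 𝒟 α D →
        DelayComp.IsSampling P 𝒟 S K T z →
        h.IsTheta T c c' (-1 / 2) (-α / (4 * α - 2)) (1 / (4 * α - 2)) 0 →
        DelayComp.HessianGap P F g h S K T x₀ z B₁ B₂ →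
        (S.maxDelay T : ℝ) ≤ cτ * (T : ℝ) ^ (α / (4 * α - 2)) →
        ∃ t ∈ Finset.Icc 1 T,
          Integrable (fun w => ‖gradient F
            (DelayComp.globalModel g h S K x₀ (fun t m k => z t m k w) (t - 1))‖ ^ 2) P ∧
          ∫ w, ‖gradient F
            (DelayComp.globalModel g h S K x₀ (fun t m k => z t m k w) (t - 1))‖ ^ 2 ∂P
              ≤ C * (T : ℝ) ^ ((1 - α) / (4 * α - 2)) := by
  let H : ℝ := √d * c' ^ 2
  let B : ℝ := K * H * (1 + √d * c' ^ 4 * cτ)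
  let E : ℝ := G * (L * (K * H + cτ * H) + c ^ (1 - α) * (4 * (G ^ α + D ^ α)))
      + c' ^ 2 * (4 * (G ^ α + D ^ α) + 1) * (G * (cτ * H))
  let C₁ : ℝ := E + (Δ₀ + L * c' ^ 2 * B ^ 2 + 1) / (c ^ 2 * K)
  let C₂ : ℝ := G ^ 2 * B / c
  have hC₁ : C₁ ≤ |C₁| + |C₂| + 1 := by linarith [le_abs_self C₁, abs_nonneg C₂]
  have hC₂ : C₂ ≤ |C₁| + |C₂| + 1 := by linarith [le_abs_self C₂, abs_nonneg C₁]
  -- The constant is fixed before any run is given, when the signs of `c'`, `cτ` and the other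
  -- bounds are still unknown; hence the absolute values.
  refine ⟨|C₁| + |C₂| + 1, by positivity, ?_⟩
  intro Ω Z _ _ P _ F x₀ g 𝒟 T h S z hT hO hg hz hθ _ hτ
  have hT' : (1 : ℝ) ≤ T := by exact_mod_cast hT
  have hT0 : (0 : ℝ) < T := by linarith
  have hα : 0 < 4 * α - 2 := by linarith
  have hq : (4 * α - 2) * (4 * α - 2)⁻¹ = 1 := mul_inv_cancel₀ hα.ne'
  have hpos : ∀ p : ℝ, 0 < (T : ℝ) ^ p := fun p => Real.rpow_pos_of_pos hT0 p
  have hc' : 0 < c' := by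
    obtain ⟨h1, h2⟩ := hθ.globalLR 1 (Finset.mem_Icc.2 ⟨le_rfl, hT⟩)
    exact pos_of_mul_pos_left (((mul_pos hc (hpos _)).trans_le h1).trans_le h2) (hpos _).le
  have hcτ : 0 ≤ cτ :=
    nonneg_of_mul_nonneg_left ((Nat.cast_nonneg _).trans hτ) (hpos _)
  have hglobalClip : ∀ t ∈ Finset.Icc 1 T, c ≤ h.globalClip t ∧ h.globalClip t ≤ c' :=
    fun t ht => by simpa using hθ.globalClip t ht
  -- The exponents solve η_ℓ u = u^(1-α) = ρ, T η² = 1 and T η η_ℓ ρ = 1 up to constants; the delay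
  -- bound is the largest with τ η = O(ρ).
  obtain ⟨t, ht, hle⟩ := DelayComp.exists_integral_norm_gradient_sq_le hM hK hz hg hO h hD.le
    hα₁.le hα₂.le hT hc hc' hcτ (hpos (-1 / 2)) (hpos (-α / (4 * α - 2)))
    (hpos (1 / (4 * α - 2))) (hpos ((1 - α) / (4 * α - 2)))
    (Real.rpow_le_one_of_one_le_of_nonpos hT' (div_nonpos_of_nonpos_of_nonneg (by linarith) hα.le))
    (by
      rw [← Real.rpow_add hT0]
      congr 1
      ring)
    (by
      rw [← Real.rpow_mul hT0.le]
      congr 1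
      ring)
    (by
      rw [← Real.rpow_mul_natCast hT0.le]
      nth_rewrite 1 [← Real.rpow_one (T : ℝ)]
      rw [← Real.rpow_add hT0]
      norm_num)
    (by
      nth_rewrite 1 [← Real.rpow_one (T : ℝ)]
      rw [← Real.rpow_add hT0, ← Real.rpow_add hT0, ← Real.rpow_add hT0]
      refine Eq.trans ?_ (Real.rpow_zero (T : ℝ))
      congr 1
      linear_combination (-1 / 2) * hq)
    hθ.globalLR hθ.localLR hθ.localClip hglobalClip
    (by
      refine (mul_le_mul_of_nonneg_right hτ (hpos (-1 / 2)).le).trans (le_of_eq ?_)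
      rw [mul_assoc, ← Real.rpow_add hT0]
      congr 2
      linear_combination (1 / 2) * hq)
    (H := H) (B := B) (E := E) rfl rfl rfl hC₁ hC₂
  refine ⟨t, ht, ?_, hle⟩
  rw [Finset.mem_Icc] at ht
  exact hz.integrable_norm_gradient_sq hg hO h (by omega)
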